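/- **Theorem 5.1.** Let $F$ be a non-archimedean local field (for example a $p$-adic field) with residue field of order $q$. Let $W_F$ be its Weil group, with inertia subgroup $I=I_F$ (open in $W_F$, with its profinite topology) and wild inertia subgroup $P_F$, and let $\mathrm{Fr}\in W_F$ be a geometric Frobenius element. Let $\kappa$ be a field of characteristic zero, and let $\rho$ be a finite-dimensional semisimple representation of $W_F$ over $\kappa$ that is smooth (continuous for the discrete topology on $\kappa$) and tamely ramified (trivial on $P_F$). Let $\sigma=\rho(s)$, where $s\in I_F$ maps to a topological generator of the tame inertia group $I_F/P_F$, and write $\mathrm{Fr}$ also for $\rho(\mathrm{Fr})$. For an endomorphism $A$ of a finite-dimensional $\kappa$-vector space put $\mathrm{Char}(A)(X)=\det(1-XA)\in\kappa[X]$, and let $$L(\rho,X)=\det\left(1-X\,\mathrm{Fr}\mid\rho^{I}\right)^{-1}\in\kappa(X),$$ where $\rho^I$ is the subspace of $I$-invariants. Then $$\det(1+\sigma+\dots+\sigma^{q-1})=q^{\dim_\kappa\rho^{I}},$$ and, in $\kappa(X)$, $$\frac{\mathrm{Char}(\mathrm{Fr})(X)}{\mathrm{Char}\big((1+\sigma+\dots+\sigma^{q-1})\,\mathrm{Fr}\big)(X)}=\frac{L(\rho,qX)}{L(\rho,X)}.$$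 -/

import Mathlib

/-!
Throughout, a non-archimedean local field is a field `F` with a nontrivial ultrametric absolute
value for which it is locally compact.  `AlgebraicClosure F` carries the unique extension of that
absolute value, which is the spectral norm.
-/

namespace LocalWeil

open Polynomial

section Galois

variable (F : Type*) [NontriviallyNormedField F] [IsUltrametricDist F]

/-- The order `q` of the residue field of the valuation ring `{x : ‖x‖ ≤ 1}` of `F`. -/
noncomputable def residueCard : ℕ :=
  Nat.card (IsLocalRing.ResidueField (NormedField.valuation (K := F)).valuationSubring)

/-- The unique extension to the algebraic closure of the absolute value of `F`. -/
noncomputable def absVal (x : AlgebraicClosure F) : ℝ :=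
  spectralNorm F (AlgebraicClosure F) x

variable {F}

theorem absVal_sub_lt {x y z : AlgebraicClosure F} {r : ℝ}
    (h₁ : absVal F (x - y) < r) (h₂ : absVal F (y - z) < r) : absVal F (x - z) < r := by
  have h := isNonarchimedean_spectralNorm (K := F) (L := AlgebraicClosure F) (x - y) (y - z)
  rw [sub_add_sub_cancel] at h
  exact lt_of_le_of_lt h (max_lt h₁ h₂)

theorem absVal_sub_comm (x y : AlgebraicClosure F) : absVal F (x - y) = absVal F (y - x) := by
  rw [← neg_sub]
  exact spectralNorm_neg (Algebra.IsAlgebraic.isAlgebraic _)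

theorem absVal_equiv (g : AlgebraicClosure F ≃ₐ[F] AlgebraicClosure F) (x : AlgebraicClosure F) :
    absVal F (g x) = absVal F x :=
  (spectralNorm_eq_of_equiv g x).symm

theorem absVal_mul_le (x y : AlgebraicClosure F) : absVal F (x * y) ≤ absVal F x * absVal F y :=
  spectralNorm_mul (Algebra.IsAlgebraic.isAlgebraic _) (Algebra.IsAlgebraic.isAlgebraic _)

theorem absVal_nonneg (x : AlgebraicClosure F) : 0 ≤ absVal F x := spectralNorm_nonneg x

theorem absVal_pow_le_one {x : AlgebraicClosure F} (hx : absVal F x ≤ 1) (k : ℕ) :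
    absVal F (x ^ k) ≤ 1 := by
  induction k with
  | zero => rw [pow_zero]; exact le_of_eq spectralNorm_one
  | succ k ih =>
    rw [pow_succ]
    exact (absVal_mul_le _ _).trans (mul_le_one₀ ih (absVal_nonneg _) hx)

theorem absVal_pow_sub_pow_lt {x y : AlgebraicClosure F} (hx : absVal F x ≤ 1)
    (hy : absVal F y ≤ 1) (h : absVal F (x - y) < 1) (k : ℕ) :
    absVal F (x ^ k - y ^ k) < 1 := by
  induction k with
  | zero =>
    rw [pow_zero, pow_zero, sub_self]
    exact lt_of_eq_of_lt spectralNorm_zero one_pos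
  | succ k ih =>
    refine absVal_sub_lt (y := x ^ k * y) ?_ ?_
    · rw [pow_succ, ← mul_sub]
      exact lt_of_le_of_lt (absVal_mul_le _ _)
        (lt_of_le_of_lt (mul_le_of_le_one_left (absVal_nonneg _) (absVal_pow_le_one hx k)) h)
    · rw [pow_succ, ← sub_mul]
      exact lt_of_le_of_lt (absVal_mul_le _ _)
        (lt_of_le_of_lt (mul_le_of_le_one_right (absVal_nonneg _) hy) ih)

/-- `g` acts on the residue field of the algebraic closure as the `(m - n)`-th power of the
arithmetic Frobenius `x ↦ x ^ q`. -/
def ActsAsFrobPow (g : AlgebraicClosure F ≃ₐ[F] AlgebraicClosure F) (m n : ℕ) : Prop :=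
  ∀ x : AlgebraicClosure F, absVal F x ≤ 1 →
    absVal F ((g x) ^ residueCard F ^ n - x ^ residueCard F ^ m) < 1

variable (F)

/-- The Weil group as an abstract subgroup of the Galois group: the elements that act on the residue
field of the algebraic closure as an integral power of the Frobenius. -/
def weilSubgroup : Subgroup (AlgebraicClosure F ≃ₐ[F] AlgebraicClosure F) where
  carrier := {g | ∃ m n : ℕ, ActsAsFrobPow g m n}
  one_mem' := ⟨0, 0, fun x _ => by
    simp [absVal, spectralNorm_zero]⟩
  mul_mem' := by
    rintro g h ⟨m, n, hg⟩ ⟨m', n', hh⟩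
    refine ⟨m + m', n + n', fun x hx => ?_⟩
    have hx' : absVal F (h x) ≤ 1 := by rw [absVal_equiv]; exact hx
    have hx'' : absVal F (g (h x)) ≤ 1 := by rw [absVal_equiv]; exact hx'
    have e₁ := absVal_pow_sub_pow_lt (absVal_pow_le_one hx'' _) (absVal_pow_le_one hx' _)
      (hg (h x) hx') (residueCard F ^ n')
    have e₂ := absVal_pow_sub_pow_lt (absVal_pow_le_one hx' _) (absVal_pow_le_one hx _)
      (hh x hx) (residueCard F ^ m)
    rw [AlgEquiv.mul_apply, pow_add, pow_add, pow_mul, mul_comm (residueCard F ^ m), pow_mul]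
    refine absVal_sub_lt e₁ ?_
    rw [← pow_mul, mul_comm, pow_mul]
    exact e₂
  inv_mem' := by
    rintro g ⟨m, n, hg⟩
    refine ⟨n, m, fun x hx => ?_⟩
    have h := hg (g⁻¹ x) (by rw [absVal_equiv]; exact hx)
    rw [show g (g⁻¹ x) = x from g.apply_symm_apply x] at h
    rw [absVal_sub_comm]
    exact h

/-- The inertia group: the automorphisms acting trivially on the residue field of the
algebraic closure. -/
def inertiaGal : Subgroup (AlgebraicClosure F ≃ₐ[F] AlgebraicClosure F) where
  carrier := {g | ∀ x, absVal F x ≤ 1 → absVal F (g x - x) < 1}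
  one_mem' := fun x _ => by
    simp [absVal, spectralNorm_zero]
  mul_mem' := fun {g h} hg hh x hx =>
    absVal_sub_lt (hg (h x) (by rw [absVal_equiv]; exact hx)) (hh x hx)
  inv_mem' := fun {g} hg x hx => by
    have h := hg (g⁻¹ x) (by rw [absVal_equiv]; exact hx)
    rw [show g (g⁻¹ x) = x from g.apply_symm_apply x, absVal_sub_comm] at h
    exact h

/-- The wild inertia group: the automorphisms `g` with `g x / x ≡ 1` modulo the maximal ideal
for all `x ≠ 0`.  It is the inverse limit of the first ramification groups `G₁` of the finite
Galois subextensions. -/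
def wildInertiaGal : Subgroup (AlgebraicClosure F ≃ₐ[F] AlgebraicClosure F) where
  carrier := {g | ∀ x, x ≠ 0 → absVal F (g x - x) < absVal F x}
  one_mem' := fun x hx => by
    simpa [absVal, spectralNorm_zero] using
      spectralNorm_zero_lt hx (Algebra.IsAlgebraic.isAlgebraic (R := F) x)
  mul_mem' := fun {g h} hg hh x hx => by
    have h₁ := hg (h x) ((map_ne_zero h).2 hx)
    rw [absVal_equiv h] at h₁
    exact absVal_sub_lt h₁ (hh x hx)
  inv_mem' := fun {g} hg x hx => by
    have h := hg (g⁻¹ x) ((map_ne_zero (g⁻¹)).2 hx)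
    rw [show g (g⁻¹ x) = x from g.apply_symm_apply x, absVal_sub_comm, absVal_equiv (g⁻¹)] at h
    exact h

/-- The Weil group `W_F`, as a type of its own because its topology is not the subspace topology
of the Galois group. -/
def WeilGroup : Type _ := weilSubgroup F

noncomputable instance : Group (WeilGroup F) := inferInstanceAs (Group (weilSubgroup F))

/-- The inclusion of the Weil group in the absolute Galois group. -/
noncomputable def WeilGroup.toGal : WeilGroup F →* (AlgebraicClosure F ≃ₐ[F] AlgebraicClosure F) :=
  (weilSubgroup F).subtype

/-- The inertia group `I_F` as a subgroup of `W_F` (it is contained in it). -/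
noncomputable def inertia : Subgroup (WeilGroup F) := (inertiaGal F).comap (WeilGroup.toGal F)

/-- The wild inertia group `P_F` as a subgroup of `W_F`. -/
noncomputable def wildInertia : Subgroup (WeilGroup F) := (wildInertiaGal F).comap (WeilGroup.toGal F)

theorem inertiaGal_le_weilSubgroup : inertiaGal F ≤ weilSubgroup F :=
  fun g hg => ⟨0, 0, fun x hx => by simpa using hg x hx⟩

theorem wildInertiaGal_le_inertiaGal : wildInertiaGal F ≤ inertiaGal F := fun g hg x hx => by
  by_cases h : x = 0
  · subst h
    simp [absVal, spectralNorm_zero]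
  · exact lt_of_lt_of_le (hg x h) hx

instance : (inertiaGal F).Normal where
  conj_mem := fun g hg h x hx => by
    have h₁ := hg (h⁻¹ x) (by rw [absVal_equiv]; exact hx)
    rw [← absVal_equiv h, map_sub, show h (h⁻¹ x) = x from h.apply_symm_apply x] at h₁
    exact h₁

instance : (wildInertiaGal F).Normal where
  conj_mem := fun g hg h x hx => by
    have h₁ := hg (h⁻¹ x) ((map_ne_zero (h⁻¹)).2 hx)
    rw [← absVal_equiv h, map_sub, show h (h⁻¹ x) = x from h.apply_symm_apply x,
      absVal_equiv (h⁻¹)] at h₁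
    exact h₁

instance : (inertia F).Normal := inferInstanceAs ((inertiaGal F).comap (WeilGroup.toGal F)).Normal

instance : (wildInertia F).Normal :=
  inferInstanceAs ((wildInertiaGal F).comap (WeilGroup.toGal F)).Normal

/-- The topology of the Weil group: the coarsest one for which the inclusion into the Galois group
(with the Krull topology) and the map to the discrete coset space `W_F / I_F` are continuous.
Thus `I_F` is open and carries its profinite topology. -/
noncomputable instance : TopologicalSpace (WeilGroup F) :=
  TopologicalSpace.induced (WeilGroup.toGal F) inferInstance ⊓
    TopologicalSpace.induced (QuotientGroup.mk : WeilGroup F → WeilGroup F ⧸ inertia F) ⊥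

variable {F}

/-- A geometric Frobenius element: it acts on the residue field of the algebraic closure as the
inverse of `x ↦ x ^ q`. -/
def IsGeometricFrobenius (φ : WeilGroup F) : Prop :=
  ActsAsFrobPow (WeilGroup.toGal F φ) 0 1

/-- `s ∈ I_F` maps to a topological generator of the tame inertia group `I_F / P_F`. -/
def IsTameGenerator (s : inertia F) : Prop :=
  Dense (Subgroup.zpowers
    (QuotientGroup.mk s : inertia F ⧸ (wildInertia F).subgroupOf (inertia F)) :
      Set (inertia F ⧸ (wildInertia F).subgroupOf (inertia F)))

end Galois

section Representations

variable {κ V : Type*} [Field κ] [AddCommGroup V] [Module κ V] [FiniteDimensional κ V]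

/-- The characteristic polynomial in the normalization `det (1 - X A)`. -/
noncomputable def charRev (A : Module.End κ V) : κ[X] :=
  (LinearMap.toMatrix (Module.finBasis κ V) (Module.finBasis κ V) A).charpolyRev

/-- `det (1 - X A)` does not depend on the basis. -/
theorem charRev_eq_reverse (A : Module.End κ V) : charRev A = A.charpoly.reverse := by
  rw [charRev, ← Matrix.reverse_charpoly, LinearMap.charpoly_toMatrix]

variable {F : Type*} [NontriviallyNormedField F] [IsUltrametricDist F]

/-- A finite-dimensional representation is smooth if it is continuous for the discrete topology
on its target. -/
def IsSmooth (ρ : Representation κ (WeilGroup F) V) : Prop :=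
  IsLocallyConstant fun w => ρ w

/-- A representation is tamely ramified if it is trivial on wild inertia. -/
def IsTamelyRamified (ρ : Representation κ (WeilGroup F) V) : Prop :=
  ∀ w ∈ wildInertia F, ρ w = 1

/-- The subspace `ρ^I` of inertial invariants. -/
noncomputable abbrev inertialInvariants (ρ : Representation κ (WeilGroup F) V) : Submodule κ V :=
  Representation.invariants (ρ.comp (inertia F).subtype)

/-- The `L`-factor `L(ρ, Y) = det (1 - Y ρ(Fr) | ρ^I)⁻¹`, evaluated at a rational function `Y`,
for a Frobenius element `Fr`. -/
noncomputable def LFactor (ρ : Representation κ (WeilGroup F) V) (Fr : WeilGroup F)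
    (Y : RatFunc κ) : RatFunc κ :=
  (aeval Y (charRev (ρ.toInvariants (inertia F) Fr)))⁻¹

/-- `1 + A + ⋯ + A ^ (q - 1)`. -/
def geomSum (q : ℕ) (A : Module.End κ V) : Module.End κ V := ∑ i ∈ Finset.range q, A ^ i

end Representations

end LocalWeil

/-!
Write `N = 1 + σ + ⋯ + σ ^ (q - 1)`.  On `ρ ^ I`, the fixed space of `σ`, the operator `N` is
multiplication by `q`.  On the quotient `V / ρ ^ I` the operator `σ - 1` is invertible, because `σ`
has finite order and hence is semisimple, and the tame relation `Fr * σ ^ q = σ * Fr` gives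
`Fr * N * (σ - 1) = Fr * (σ ^ q - 1) = (σ - 1) * Fr`.  So on the quotient `N` has determinant `1`
and `Fr * N` is conjugate to `Fr`; there `N * Fr` and `Fr` have the same characteristic polynomial.

The tame relation holds because, for `g` in the inertia group, the residue class of `g x / x`
depends only on `|x|`, is multiplicative in `g` and determines `g` modulo wild inertia, while
conjugating `g` by an element of the Galois group applies that element to the residue class.
-/

namespace LocalWeil

open Polynomial

section LinearAlgebra

theorem charpoly_eq_restrict_mul_mapQ {R M : Type*} [CommRing R] [AddCommGroup M] [Module R M]
    [Module.Free R M] [Module.Finite R M] (U : Submodule R M) [Module.Free R U] [Module.Finite R U]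
    [Module.Free R (M ⧸ U)] (f : Module.End R M) (hf : U ≤ U.comap f) :
    f.charpoly = (f.restrict hf).charpoly * (U.mapQ U f hf).charpoly := by
  set bU := Module.Free.chooseBasis R U
  set bQ := Module.Free.chooseBasis R (M ⧸ U)
  set b := bU.sumQuot bQ
  have h₁₁ : (f.toMatrix b b).toBlocks₁₁ = (f.restrict hf).toMatrix bU bU := by
    ext i j
    simp only [Matrix.toBlocks₁₁, Matrix.of_apply, LinearMap.toMatrix_apply, b,
      Module.Basis.sumQuot_inl]
    apply Module.Basis.sumQuot_repr_inl_of_mem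
  have h₂₁ : (f.toMatrix b b).toBlocks₂₁ = 0 := by
    ext i j
    simp only [Matrix.toBlocks₂₁, Matrix.of_apply, LinearMap.toMatrix_apply, b,
      Module.Basis.sumQuot_inl]
    exact Module.Basis.sumQuot_repr_inr_of_mem bU bQ _ (hf (bU j).2) i
  have h₂₂ : (f.toMatrix b b).toBlocks₂₂ = (U.mapQ U f hf).toMatrix bQ bQ := by
    ext i j
    simp only [Matrix.toBlocks₂₂, Matrix.of_apply, LinearMap.toMatrix_apply, b,
      Module.Basis.sumQuot_repr_inr]
    rw [← Module.Basis.sumQuot_inr bU bQ j]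
    rfl
  rw [← f.charpoly_toMatrix b, ← Matrix.fromBlocks_toBlocks (f.toMatrix b b), h₁₁, h₂₁, h₂₂,
    Matrix.charpoly_fromBlocks_zero₂₁, LinearMap.charpoly_toMatrix, LinearMap.charpoly_toMatrix]

variable {κ V : Type*} [Field κ] [AddCommGroup V] [Module κ V]
  {σ Φ : Module.End κ V} {q : ℕ} {U : Submodule κ V}

theorem mul_geomSum_mul_sub_one (hΦ : Φ * σ ^ q = σ * Φ) :
    Φ * geomSum q σ * (σ - 1) = (σ - 1) * Φ := by
  rw [mul_assoc, geomSum, geom_sum_mul, mul_sub, hΦ, sub_mul, one_mul, mul_one]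

theorem geomSum_apply_of_apply_eq {x : V} (hx : σ x = x) : geomSum q σ x = (q : κ) • x := by
  have hpow (i : ℕ) : (σ ^ i) x = x := by
    rw [Module.End.pow_apply, Function.iterate_fixed hx]
  simp [geomSum, hpow, Nat.cast_smul_eq_nsmul]

theorem le_comap_geomSum (hσU : U ≤ U.comap σ) : U ≤ U.comap (geomSum q σ) := by
  intro x hx
  rw [Submodule.mem_comap, geomSum, LinearMap.sum_apply]
  exact U.sum_mem fun i _ => U.le_comap_pow_of_le_comap hσU i hx

theorem mapQ_geomSum (hσU : U ≤ U.comap σ) :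
    U.mapQ U (geomSum q σ) (le_comap_geomSum hσU) = geomSum q (U.mapQ U σ hσU) := by
  simp only [geomSum, ← U.mapQ_pow hσU]
  ext x
  simp only [LinearMap.comp_apply, LinearMap.sum_apply, Submodule.mkQ_apply, Submodule.mapQ_apply]
  exact map_sum U.mkQ _ _

theorem mapQ_mul_mapQ_pow (hσU : U ≤ U.comap σ) (hΦU : U ≤ U.comap Φ)
    (hΦ : Φ * σ ^ q = σ * Φ) :
    U.mapQ U Φ hΦU * U.mapQ U σ hσU ^ q = U.mapQ U σ hσU * U.mapQ U Φ hΦU := by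
  rw [← Submodule.mapQ_pow]
  ext x
  exact congrArg U.mkQ (LinearMap.congr_fun hΦ x)

theorem det_geomSum_of_isUnit_sub_one (hσ : IsUnit (σ - 1)) (hΦ₀ : IsUnit Φ)
    (hΦ : Φ * σ ^ q = σ * Φ) : LinearMap.det (geomSum q σ) = 1 := by
  have h := congrArg LinearMap.det (mul_geomSum_mul_sub_one hΦ)
  simp only [map_mul] at h
  refine mul_left_cancel₀ (mul_ne_zero (hΦ₀.map LinearMap.det).ne_zero
    (hσ.map LinearMap.det).ne_zero) ?_
  linear_combination h

theorem isSemisimple_of_pow_eq_one {n : ℕ} (hn : (n : κ) ≠ 0) (hσ : σ ^ n = 1) :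
    σ.IsSemisimple :=
  Module.End.isSemisimple_of_squarefree_aeval_eq_zero
    (X_pow_sub_one_separable_iff.2 hn).squarefree (by simp [hσ])

variable [FiniteDimensional κ V]

theorem isUnit_mapQ_sub_one (hσ : σ.IsSemisimple) (hU : ∀ x, x ∈ U ↔ σ x = x)
    (hσU : U ≤ U.comap σ) : IsUnit (U.mapQ U σ hσU - 1) := by
  rw [LinearMap.isUnit_iff_ker_eq_bot, LinearMap.ker_eq_bot']
  intro y hy
  obtain ⟨x, rfl⟩ := U.mkQ_surjective y
  have hmem : (σ - 1) x ∈ U := (Submodule.Quotient.mk_eq_zero U).1 hy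
  have hx₂ : x ∈ σ.genEigenspace 1 (2 : ℕ) := by
    rw [Module.End.mem_genEigenspace_nat, one_smul, LinearMap.mem_ker, pow_two,
      Module.End.mul_apply, LinearMap.sub_apply σ, (hU _).1 hmem, Module.End.one_apply, sub_self]
  rw [hσ.isFinitelySemisimple.genEigenspace_eq_eigenspace 1 (k := (2 : ℕ)) (by simp),
    Module.End.mem_eigenspace_iff, one_smul] at hx₂
  exact (Submodule.Quotient.mk_eq_zero U).2 ((hU x).2 hx₂)

theorem det_geomSum (hσ : σ.IsSemisimple) (hΦ₀ : IsUnit Φ) (hΦ : Φ * σ ^ q = σ * Φ)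
    (hU : ∀ x, x ∈ U ↔ σ x = x) (hΦU : U ≤ U.comap Φ) :
    LinearMap.det (geomSum q σ) = (q : κ) ^ Module.finrank κ U := by
  have hσU : U ≤ U.comap σ := fun x hx => by rwa [Submodule.mem_comap, (hU x).1 hx]
  have hrestrict : (geomSum q σ).restrict (le_comap_geomSum hσU) = (q : κ) • 1 :=
    LinearMap.ext fun x => Subtype.ext (geomSum_apply_of_apply_eq ((hU x).1 x.2))
  have hΦQ₀ : IsUnit (U.mapQ U Φ hΦU) := by
    rw [LinearMap.isUnit_iff_isUnit_det, LinearMap.det_eq_det_mul_det U Φ hΦU] at *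
    exact isUnit_of_mul_isUnit_right hΦ₀
  rw [LinearMap.det_eq_det_mul_det U _ (le_comap_geomSum hσU), hrestrict, mapQ_geomSum hσU,
    det_geomSum_of_isUnit_sub_one (isUnit_mapQ_sub_one hσ hU hσU) hΦQ₀
      (mapQ_mul_mapQ_pow hσU hΦU hΦ)]
  simp

theorem charRev_eq_restrict_mul_mapQ (f : Module.End κ V) (hf : U ≤ U.comap f) :
    charRev f = charRev (f.restrict hf) * charRev (U.mapQ U f hf) := by
  simp only [charRev_eq_reverse, charpoly_eq_restrict_mul_mapQ U f hf, reverse_mul_of_domain]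

theorem charRev_mul_comm (A B : Module.End κ V) : charRev (A * B) = charRev (B * A) := by
  simp only [charRev, ← Matrix.reverse_charpoly, LinearMap.toMatrix_mul, Matrix.charpoly_mul_comm]

theorem charRev_smul (c : κ) (A : Module.End κ V) :
    charRev (c • A) = (charRev A).comp (C c * X) := by
  rw [← coe_compRingHom_apply, charRev, charRev, Matrix.charpolyRev, Matrix.charpolyRev,
    RingHom.map_det]
  congr 1
  refine Matrix.ext fun i j => ?_
  by_cases hij : i = j <;> simp [hij] <;> ring

theorem charRev_ne_zero (A : Module.End κ V) : charRev A ≠ 0 := by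
  rw [charRev_eq_reverse, Ne, reverse_eq_zero]
  exact A.charpoly_monic.ne_zero

theorem charRev_geomSum_mul_of_isUnit_sub_one (hσ : IsUnit (σ - 1)) (hΦ : Φ * σ ^ q = σ * Φ) :
    charRev (geomSum q σ * Φ) = charRev Φ := by
  obtain ⟨u, hu⟩ := hσ
  have hconj : Φ * geomSum q σ = u * Φ * ↑u⁻¹ := by
    rw [Units.eq_mul_inv_iff_mul_eq, hu, mul_geomSum_mul_sub_one hΦ]
  rw [charRev_mul_comm, hconj, mul_assoc, charRev_mul_comm, mul_assoc, Units.inv_mul, mul_one]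

theorem charRev_geomSum_mul (hσ : σ.IsSemisimple) (hΦ : Φ * σ ^ q = σ * Φ)
    (hU : ∀ x, x ∈ U ↔ σ x = x) (hΦU : U ≤ U.comap Φ) :
    charRev (geomSum q σ * Φ) =
      (charRev (Φ.restrict hΦU)).comp (C (q : κ) * X) * charRev (U.mapQ U Φ hΦU) := by
  have hσU : U ≤ U.comap σ := fun x hx => by rwa [Submodule.mem_comap, (hU x).1 hx]
  have hNΦU : U ≤ U.comap (geomSum q σ * Φ) := fun x hx => le_comap_geomSum hσU (hΦU hx)
  have hrestrict : (geomSum q σ * Φ).restrict hNΦU = (q : κ) • Φ.restrict hΦU :=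
    LinearMap.ext fun x =>
      Subtype.ext (geomSum_apply_of_apply_eq ((hU _).1 (hΦU x.2)))
  have hmapQ : U.mapQ U (geomSum q σ * Φ) hNΦU = geomSum q (U.mapQ U σ hσU) * U.mapQ U Φ hΦU := by
    rw [← mapQ_geomSum hσU]
    exact U.mapQ_comp U U _ _ hΦU (le_comap_geomSum hσU) hNΦU
  rw [charRev_eq_restrict_mul_mapQ _ hNΦU, hrestrict, charRev_smul, hmapQ,
    charRev_geomSum_mul_of_isUnit_sub_one (isUnit_mapQ_sub_one hσ hU hσU)
      (mapQ_mul_mapQ_pow hσU hΦU hΦ)]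

end LinearAlgebra

section TameRelation

variable {F : Type*} [NontriviallyNormedField F]

theorem absVal_pos {x : AlgebraicClosure F} (hx : x ≠ 0) : 0 < absVal F x :=
  spectralNorm_zero_lt hx (Algebra.IsAlgebraic.isAlgebraic (R := F) x)

/-- Congruence modulo the maximal ideal of the ring of integers of the algebraic closure: for
integral `x` and `y`, equality in the residue field. -/
def ResidueEq (x y : AlgebraicClosure F) : Prop := absVal F (x - y) < 1

variable [IsUltrametricDist F]

theorem ResidueEq.symm {x y : AlgebraicClosure F} (h : ResidueEq x y) : ResidueEq y x := by
  rwa [ResidueEq, absVal_sub_comm]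

theorem ResidueEq.trans {x y z : AlgebraicClosure F} (hxy : ResidueEq x y) (hyz : ResidueEq y z) :
    ResidueEq x z :=
  absVal_sub_lt hxy hyz

instance : Trans (ResidueEq (F := F)) ResidueEq ResidueEq := ⟨ResidueEq.trans⟩

theorem ResidueEq.pow {x y : AlgebraicClosure F} (h : ResidueEq x y) (hx : absVal F x ≤ 1)
    (hy : absVal F y ≤ 1) (k : ℕ) : ResidueEq (x ^ k) (y ^ k) :=
  absVal_pow_sub_pow_lt hx hy h k

variable [CompleteSpace F] {g h φ : AlgebraicClosure F ≃ₐ[F] AlgebraicClosure F}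

theorem absVal_mul (x y : AlgebraicClosure F) : absVal F (x * y) = absVal F x * absVal F y :=
  map_mul (spectralMulAlgNorm F (AlgebraicClosure F)) x y

theorem absVal_div (x y : AlgebraicClosure F) : absVal F (x / y) = absVal F x / absVal F y :=
  map_div₀ (spectralMulAlgNorm F (AlgebraicClosure F)) x y

theorem absVal_div_eq_one {x y : AlgebraicClosure F} (hy : y ≠ 0) (h : absVal F x = absVal F y) :
    absVal F (x / y) = 1 := by
  rw [absVal_div, h, div_self (absVal_pos hy).ne']

theorem absVal_apply_div_self (g : AlgebraicClosure F ≃ₐ[F] AlgebraicClosure F)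
    {x : AlgebraicClosure F} (hx : x ≠ 0) : absVal F (g x / x) = 1 :=
  absVal_div_eq_one hx (absVal_equiv g x)

theorem ResidueEq.mul_right {x y z : AlgebraicClosure F} (h : ResidueEq x y)
    (hz : absVal F z = 1) : ResidueEq (x * z) (y * z) := by
  rwa [ResidueEq, ← sub_mul, absVal_mul, hz, mul_one]

theorem residueEq_apply_div_self (hg : g ∈ inertiaGal F) {x y : AlgebraicClosure F} (hx : x ≠ 0)
    (hy : y ≠ 0) (hxy : absVal F x = absVal F y) : ResidueEq (g x / x) (g y / y) := by
  have hgy : g y ≠ 0 := (map_ne_zero g).2 hy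
  have hunit : absVal F (g y / x) = 1 := absVal_div_eq_one hx (by rw [absVal_equiv, hxy])
  have hresidue : ResidueEq (g (x / y)) (x / y) := hg _ (absVal_div_eq_one hy hxy).le
  calc
    g x / x = g (x / y) * (g y / x) := by rw [map_div₀]; field_simp
    ResidueEq _ (x / y * (g y / x)) := hresidue.mul_right hunit
    _ = g y / y := by field_simp

theorem residueEq_pow_apply_div_self (hg : g ∈ inertiaGal F) {x : AlgebraicClosure F} (hx : x ≠ 0)
    (k : ℕ) : ResidueEq ((g ^ k) x / x) ((g x / x) ^ k) := by
  induction k with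
  | zero => simp [ResidueEq, hx, absVal, spectralNorm_zero]
  | succ k ih =>
    have hgx : g x ≠ 0 := (map_ne_zero g).2 hx
    have hunit := absVal_apply_div_self g hx
    calc
      (g ^ (k + 1)) x / x = (g ^ k) (g x) / g x * (g x / x) := by
        rw [pow_succ, AlgEquiv.mul_apply]; field_simp
      ResidueEq _ ((g ^ k) x / x * (g x / x)) :=
        (residueEq_apply_div_self (pow_mem hg k) hgx hx (absVal_equiv g x)).mul_right hunit
      ResidueEq _ ((g x / x) ^ k * (g x / x)) := ih.mul_right hunit
      _ = (g x / x) ^ (k + 1) := (pow_succ _ _).symm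

theorem inv_mul_mem_wildInertiaGal
    (hgh : ∀ x : AlgebraicClosure F, x ≠ 0 → ResidueEq (g x / x) (h x / x)) :
    g⁻¹ * h ∈ wildInertiaGal F := by
  intro x hx
  have hlt : absVal F (h x / x - g x / x) < 1 := (hgh x hx).symm
  rwa [← sub_div, absVal_div, div_lt_one (absVal_pos hx), ← g.apply_symm_apply (h x), ← map_sub,
    absVal_equiv] at hlt

theorem inv_pow_mul_conj_pow_mem_wildInertiaGal {m n : ℕ} (hg : g ∈ inertiaGal F)
    (hφ : ActsAsFrobPow φ m n) :
    (g ^ residueCard F ^ m)⁻¹ * (φ * g * φ⁻¹) ^ residueCard F ^ n ∈ wildInertiaGal F := by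
  refine inv_mul_mem_wildInertiaGal fun x hx => ResidueEq.symm ?_
  have hconj : φ * g * φ⁻¹ ∈ inertiaGal F :=
    (inferInstance : (inertiaGal F).Normal).conj_mem g hg φ
  obtain ⟨y, rfl⟩ := φ.surjective x
  have hy : y ≠ 0 := (map_ne_zero φ).1 hx
  calc
    ResidueEq (((φ * g * φ⁻¹) ^ residueCard F ^ n) (φ y) / φ y)
      (((φ * g * φ⁻¹) (φ y) / φ y) ^ residueCard F ^ n) :=
        residueEq_pow_apply_div_self hconj hx _
    _ = φ (g y / y) ^ residueCard F ^ n := by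
      rw [map_div₀]
      simp
    ResidueEq _ ((g y / y) ^ residueCard F ^ m) := hφ _ (absVal_apply_div_self g hy).le
    ResidueEq _ ((g (φ y) / φ y) ^ residueCard F ^ m) :=
      (residueEq_apply_div_self hg hy hx (absVal_equiv φ y).symm).pow
        (absVal_apply_div_self g hy).le (absVal_apply_div_self g hx).le _
    ResidueEq _ ((g ^ residueCard F ^ m) (φ y) / φ y) :=
      (residueEq_pow_apply_div_self hg hx _).symm

end TameRelation

theorem exists_pow_mem_of_mem_nhds_one {K L : Type*} [Field K] [Field L] [Algebra K L] [Normal K L]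
    {S : Set Gal(L/K)} (hS : S ∈ nhds 1) (g : Gal(L/K)) : ∃ n ≠ 0, g ^ n ∈ S := by
  obtain ⟨E, _, _, hES⟩ := (krullTopology_mem_nhds_one_iff_of_normal K L S).1 hS
  refine ⟨Nat.card Gal(E/K), Nat.card_pos.ne', hES ?_⟩
  rw [SetLike.mem_coe, ← E.restrictNormalHom_ker, MonoidHom.mem_ker, map_pow, pow_card_eq_one']

theorem mem_invariants_iff_of_dense_zpowers {k G V : Type*} [CommRing k] [Group G]
    [TopologicalSpace G] [AddCommGroup V] [Module k V] {ρ : Representation k G V}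
    (hρ : IsLocallyConstant ρ) {g : G} (hg : Dense (Subgroup.zpowers g : Set G)) (x : V) :
    x ∈ ρ.invariants ↔ ρ g x = x := by
  refine ⟨fun hx => hx g, fun hx h => ?_⟩
  have hclosed : IsClosed {h | ρ h x = x} := (hρ.comp fun A => A x).isClosed_fiber x
  have hzpowers : (Subgroup.zpowers g : Set G) ⊆ {h | ρ h x = x} := fun h hh =>
    (Representation.mem_invariants_iff_of_forall_mem_zpowers (ρ.comp (Subgroup.zpowers g).subtype)
      ⟨g, Subgroup.mem_zpowers g⟩ (by rintro ⟨_, i, rfl⟩; exact ⟨i, rfl⟩) x).2 hx ⟨h, hh⟩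
  exact hclosed.closure_subset_iff.2 hzpowers (hg h)

section WeilRepresentation

variable {F : Type*} [NontriviallyNormedField F] [IsUltrametricDist F]
  {κ V : Type*} [Field κ] [AddCommGroup V] [Module κ V] {ρ : Representation κ (WeilGroup F) V}

theorem isInducing_toGal_inertia :
    Topology.IsInducing fun s : inertia F => WeilGroup.toGal F s := by
  have hconst : (QuotientGroup.mk : WeilGroup F → WeilGroup F ⧸ inertia F) ∘
      (Subtype.val : inertia F → WeilGroup F) = fun _ => 1 :=
    funext fun s => (QuotientGroup.eq_one_iff _).2 s.2
  refine ⟨(induced_inf (t₁ := .induced (WeilGroup.toGal F) inferInstance)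
    (t₂ := .induced QuotientGroup.mk ⊥)).trans ?_⟩
  rw [induced_compose, induced_compose, hconst, @induced_const _ _ ⊥, inf_top_eq]
  rfl

theorem IsSmooth.exists_pow_eq_one (hρ : IsSmooth ρ) (s : inertia F) : ∃ n ≠ 0, ρ s ^ n = 1 := by
  have hnhds : {t : inertia F | ρ t = 1} ∈ nhds 1 :=
    ((hρ.isOpen_fiber 1).preimage continuous_subtype_val).mem_nhds (map_one ρ)
  rw [isInducing_toGal_inertia.nhds_eq_comap, Filter.mem_comap] at hnhds
  obtain ⟨S, hS, hSρ⟩ := hnhds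
  obtain ⟨n, hn, hpow⟩ := exists_pow_mem_of_mem_nhds_one (by simpa using hS) (WeilGroup.toGal F s)
  refine ⟨n, hn, ?_⟩
  rw [← map_pow]
  exact @hSρ (s ^ n) (by simpa using hpow)

theorem IsSmooth.isSemisimple [CharZero κ] (hρ : IsSmooth ρ) (s : inertia F) :
    Module.End.IsSemisimple (ρ s) := by
  obtain ⟨n, hn, hpow⟩ := hρ.exists_pow_eq_one s
  exact isSemisimple_of_pow_eq_one (Nat.cast_ne_zero.2 hn) hpow

theorem IsTamelyRamified.map_eq (htame : IsTamelyRamified ρ) {v w : WeilGroup F}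
    (h : v⁻¹ * w ∈ wildInertia F) : ρ v = ρ w := by
  rw [← mul_inv_cancel_left v w, map_mul, htame _ h, mul_one]

theorem IsTamelyRamified.map_mul_map_pow [CompleteSpace F] (htame : IsTamelyRamified ρ)
    {w : WeilGroup F} {m n : ℕ} (hw : ActsAsFrobPow (WeilGroup.toGal F w) m n) (s : inertia F) :
    ρ w * ρ s ^ residueCard F ^ n = ρ s ^ residueCard F ^ m * ρ w := by
  have hwild : ((s : WeilGroup F) ^ residueCard F ^ m)⁻¹ * (w * s * w⁻¹) ^ residueCard F ^ n ∈
      wildInertia F := by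
    rw [wildInertia, Subgroup.mem_comap]
    simpa using inv_pow_mul_conj_pow_mem_wildInertiaGal s.2 hw
  rw [← map_pow, ← map_pow, htame.map_eq hwild, ← map_mul, ← map_mul, conj_pow,
    inv_mul_cancel_right]

theorem mem_inertialInvariants_iff (hρ : IsSmooth ρ) (htame : IsTamelyRamified ρ) {s : inertia F}
    (hs : IsTameGenerator s) (x : V) : x ∈ inertialInvariants ρ ↔ ρ s x = x := by
  let P := (wildInertia F).subgroupOf (inertia F)
  let ρI : Representation κ (inertia F) V := ρ.comp (inertia F).subtype
  have : Representation.IsTrivial (ρI.comp P.subtype) := ⟨fun t => htame _ t.2⟩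
  have hlc : IsLocallyConstant (ρI.ofQuotient P) := fun A =>
    isOpen_coinduced.2 ((hρ A).preimage continuous_subtype_val)
  have hfixed : x ∈ (ρI.ofQuotient P).invariants ↔ ρ s x = x :=
    mem_invariants_iff_of_dense_zpowers hlc hs x
  exact (QuotientGroup.mk_surjective (s := P)).forall.symm.trans hfixed

end WeilRepresentation

section LFactor

variable {F : Type*} [NontriviallyNormedField F] [IsUltrametricDist F]
  {κ V : Type*} [Field κ] [AddCommGroup V] [Module κ V] [FiniteDimensional κ V]
  (ρ : Representation κ (WeilGroup F) V) (Fr : WeilGroup F)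

theorem LFactor_C_mul_X (c : κ) :
    LFactor ρ Fr (RatFunc.C c * RatFunc.X) = (algebraMap κ[X] (RatFunc κ)
      ((charRev (ρ.toInvariants (inertia F) Fr)).comp (C c * X)))⁻¹ := by
  rw [LFactor, comp_eq_aeval, ← aeval_algebraMap_apply, map_mul, RatFunc.algebraMap_C,
    RatFunc.algebraMap_X]

theorem LFactor_X :
    LFactor ρ Fr RatFunc.X =
      (algebraMap κ[X] (RatFunc κ) (charRev (ρ.toInvariants (inertia F) Fr)))⁻¹ := by
  simpa using LFactor_C_mul_X ρ Fr 1

end LFactor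

end LocalWeil

theorem theorem5p1_general
    {F : Type*} [NontriviallyNormedField F] [IsUltrametricDist F] [CompleteSpace F]
    {κ : Type*} [Field κ]
    {V : Type*} [AddCommGroup V] [Module κ V] [FiniteDimensional κ V]
    (ρ : Representation κ (LocalWeil.WeilGroup F) V)
    (hsmooth : LocalWeil.IsSmooth ρ)
    (htame : LocalWeil.IsTamelyRamified ρ)
    (s : LocalWeil.inertia F) (hs : LocalWeil.IsTameGenerator s)
    (hσ : Module.End.IsSemisimple (ρ s))
    (Fr : LocalWeil.WeilGroup F) (hFr : LocalWeil.IsGeometricFrobenius Fr) :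
    LinearMap.det (LocalWeil.geomSum (LocalWeil.residueCard F) (ρ s)) =
        (LocalWeil.residueCard F : κ) ^ Module.finrank κ (LocalWeil.inertialInvariants ρ) ∧
      (algebraMap (Polynomial κ) (RatFunc κ) (LocalWeil.charRev (ρ Fr))) /
          (algebraMap (Polynomial κ) (RatFunc κ) (LocalWeil.charRev
            (LocalWeil.geomSum (LocalWeil.residueCard F) (ρ s) * ρ Fr))) =
        LocalWeil.LFactor ρ Fr (RatFunc.C (LocalWeil.residueCard F : κ) * RatFunc.X) /
          LocalWeil.LFactor ρ Fr RatFunc.X := by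
  have hinv := LocalWeil.mem_inertialInvariants_iff hsmooth htame hs
  have hle := ρ.le_comap_invariants (LocalWeil.inertia F) Fr
  have hrel : ρ Fr * ρ s ^ LocalWeil.residueCard F = ρ s * ρ Fr := by
    simpa using htame.map_mul_map_pow hFr s
  refine ⟨LocalWeil.det_geomSum hσ ((Group.isUnit Fr).map ρ) hrel hinv hle, ?_⟩
  rw [LocalWeil.charRev_eq_restrict_mul_mapQ (ρ Fr) hle,
    LocalWeil.charRev_geomSum_mul hσ hrel hinv hle, map_mul, map_mul,
    mul_div_mul_right _ _ (RatFunc.algebraMap_ne_zero (LocalWeil.charRev_ne_zero _)),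
    LocalWeil.LFactor_C_mul_X, LocalWeil.LFactor_X, inv_div_inv]
  rfl

theorem theorem5p1
    {F : Type*} [NontriviallyNormedField F] [IsUltrametricDist F] [LocallyCompactSpace F]
    {κ : Type*} [Field κ] [CharZero κ]
    {V : Type*} [AddCommGroup V] [Module κ V] [FiniteDimensional κ V]
    (ρ : Representation κ (LocalWeil.WeilGroup F) V)
    (hsemisimple : ρ.IsSemisimpleRepresentation)
    (hsmooth : LocalWeil.IsSmooth ρ)
    (htame : LocalWeil.IsTamelyRamified ρ)
    (s : LocalWeil.inertia F) (hs : LocalWeil.IsTameGenerator s)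
    (Fr : LocalWeil.WeilGroup F) (hFr : LocalWeil.IsGeometricFrobenius Fr) :
    LinearMap.det (LocalWeil.geomSum (LocalWeil.residueCard F) (ρ s)) =
        (LocalWeil.residueCard F : κ) ^ Module.finrank κ (LocalWeil.inertialInvariants ρ) ∧
      (algebraMap (Polynomial κ) (RatFunc κ) (LocalWeil.charRev (ρ Fr))) /
          (algebraMap (Polynomial κ) (RatFunc κ) (LocalWeil.charRev
            (LocalWeil.geomSum (LocalWeil.residueCard F) (ρ s) * ρ Fr))) =
        LocalWeil.LFactor ρ Fr (RatFunc.C (LocalWeil.residueCard F : κ) * RatFunc.X) /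
          LocalWeil.LFactor ρ Fr RatFunc.X := by
  have : CompleteSpace F := IsRightUniformAddGroup.completeSpace_of_weaklyLocallyCompactSpace
  exact theorem5p1_general ρ hsmooth htame s hs (hsmooth.isSemisimple s) Fr hFr
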